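/- Let $m\ge 3$ be a fixed integer and let $(A_i)_{i\in\mathbb N}$ be a sequence of independent random vectors, each uniformly distributed on the unit sphere $\mathrm S^{m-1}\subset\mathbb R^m$. For $n\ge 1$ let $A^{[n]}=[A_1,\dots,A_n]^{\mathrm T}$ be the random $n\times m$ matrix with rows $A_1,\dots,A_n$. For a real $n\times m$ matrix $A$ with nonzero rows $a_1,\dots,a_n$ and $x\in\mathbb R^m\setminus\{0\}$ put $$\theta(A,x)=\min_{1\le i\le n}\arccos\frac{a_i\cdot x}{\|a_i\|\,\|x\|},\qquad \theta(A)=\sup_{x\in\mathbb R^m\setminus\{0\}}\theta(A,x),\qquad \mathscr C(A)=\frac1{|\cos\theta(A)|}\in[1,\infty],$$ where $\mathscr C(A)=\infty$ if $\cos\theta(A)=0$, and $\infty^0=1$. Then for every real $\gamma\in[0,1)$, $$\lim_{n\to\infty}\mathbf E\bigl[\mathscr C(A^{[n]})^{\gamma}\bigr]=1 .$$ -/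

import Mathlib

open Filter Topology MeasureTheory ProbabilityTheory

noncomputable section

/-- The `i`-th row of a real matrix, as a vector of Euclidean space `ℝᵐ`. -/
def rowVec {n m : ℕ} (A : Matrix (Fin n) (Fin m) ℝ) (i : Fin n) : EuclideanSpace ℝ (Fin m) :=
  WithLp.toLp 2 (A i)

/-- `θ(A, x)`: the smallest of the angles (in `[0, π]`) between `x` and the rows of `A`. -/
def minAngle {n m : ℕ} (A : Matrix (Fin n) (Fin m) ℝ) (x : EuclideanSpace ℝ (Fin m)) : ℝ :=
  ⨅ i : Fin n, InnerProductGeometry.angle (rowVec A i) x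

/-- `θ(A)`: the supremum of `θ(A, x)` over all nonzero `x`. -/
def maxMinAngle {n m : ℕ} (A : Matrix (Fin n) (Fin m) ℝ) : ℝ :=
  ⨆ x : {x : EuclideanSpace ℝ (Fin m) // x ≠ 0}, minAngle A x

/-- The condition number `𝒞(A) = |cos θ(A)|⁻¹` of the system `A x ≤ 0, x ≠ 0`, with values in
`[0, ∞]`; it is `∞` exactly when `cos θ(A) = 0`. -/
def condNumber {n m : ℕ} (A : Matrix (Fin n) (Fin m) ℝ) : ENNReal :=
  (ENNReal.ofReal |Real.cos (maxMinAngle A)|)⁻¹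

/-- The uniform distribution on the unit sphere of `ℝᵐ`: the surface measure induced by Lebesgue
measure, divided by its total mass. -/
def uniformSphere (m : ℕ) : Measure (Metric.sphere (0 : EuclideanSpace ℝ (Fin m)) 1) :=
  ((volume : Measure (EuclideanSpace ℝ (Fin m))).toSphere Set.univ)⁻¹ •
    (volume : Measure (EuclideanSpace ℝ (Fin m))).toSphere

/-- The `n × m` matrix whose rows are the first `n` vectors of a sequence on the unit sphere. -/
def firstRows {m : ℕ} (a : ℕ → Metric.sphere (0 : EuclideanSpace ℝ (Fin m)) 1) (n : ℕ) :
    Matrix (Fin n) (Fin m) ℝ :=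
  Matrix.of fun i j => (a i : EuclideanSpace ℝ (Fin m)) j

end

/-! The lower bound is `one_le_condNumber`. For the upper bound, `cos θ(A)` is the minimum over unit
`x` of the largest inner product of a row with `x` (`cos_maxMinAngle_eq`). Two estimates control it.
Optimality at a minimizer puts some row within `m |cos θ|` of the span of fewer than `m` other rows.
A row independent of that span falls so near it with probability `O(|cos θ|)`, so a union bound
gives the tail `D n^(m+1) / t` for `𝒞 ≥ t` at dyadic `t`. For `c < 1`, covering the sphere by
finitely many balls shows that `cos θ ≥ c` fails only on an event `B` of probability at most `N q^n`
with `q < 1`. Off `B`, `𝒞^γ ≤ 1/c`. On `B`, interpolating the two bounds with weight `β`, `γ < β <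
1`, makes the dyadic sum converge and leaves an exponentially small factor that beats the
polynomial. Finally `c` is taken close to `1`. -/

/-! ### Minimax directions and their optimality conditions. -/

section Geometry

variable {ι E : Type*} [NormedAddCommGroup E] [InnerProductSpace ℝ E]

/-- `x₀` minimizes `x ↦ max_{i ∈ t} ⟪a i, x⟫` over the unit sphere, with minimal value `ρ`. -/
structure IsMinimaxDirection (a : ι → E) (t : Finset ι) (x₀ : E) (ρ : ℝ) : Prop where
  norm_eq : ‖x₀‖ = 1
  inner_le : ∀ i ∈ t, inner ℝ (a i) x₀ ≤ ρ
  exists_le : ∀ x : E, ‖x‖ = 1 → ∃ i ∈ t, ρ ≤ inner ℝ (a i) x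

theorem exists_isMinimaxDirection [FiniteDimensional ℝ E] [Nontrivial E] (a : ι → E)
    {t : Finset ι} (ht : t.Nonempty) : ∃ x₀ ρ, IsMinimaxDirection a t x₀ ρ := by
  have hcont : Continuous fun x : E => t.sup' ht fun i => inner ℝ (a i) x :=
    Continuous.finset_sup'_apply ht fun i _ => by fun_prop
  obtain ⟨x₀, hx₀, hmin⟩ := (isCompact_sphere (0 : E) 1).exists_isMinOn
    (NormedSpace.sphere_nonempty.2 zero_le_one) hcont.continuousOn
  refine ⟨x₀, t.sup' ht fun i => inner ℝ (a i) x₀, by simpa using hx₀,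
    fun i hi => Finset.le_sup' (fun i => inner ℝ (a i) x₀) hi, fun x hx => ?_⟩
  have h := hmin (show x ∈ Metric.sphere (0 : E) 1 by simpa using hx)
  exact (Finset.le_sup'_iff ht).1 h

/-- First-order optimality: a tangent step `s • w` would lower every active constraint at order `s`,
while renormalizing costs only order `s ^ 2` and inactive constraints stay slack. -/
theorem IsMinimaxDirection.not_forall_inner_neg {a : ι → E} {t : Finset ι} {x₀ : E} {ρ : ℝ}
    (h : IsMinimaxDirection a t x₀ ρ) {w : E} (hw : inner ℝ x₀ w = 0) :
    ¬ ∀ i ∈ t, inner ℝ (a i) x₀ = ρ → inner ℝ (a i) w < 0 := by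
  intro hneg
  have hnorm : ∀ s : ℝ, ‖x₀ + s • w‖ ^ 2 = 1 + s ^ 2 * ‖w‖ ^ 2 := fun s => by
    rw [norm_add_sq_real, norm_smul, inner_smul_right, hw, h.norm_eq, mul_pow, Real.norm_eq_abs,
      sq_abs]
    ring
  have hge : ∀ s : ℝ, 1 ≤ ‖x₀ + s • w‖ := fun s => by
    have := hnorm s
    nlinarith [norm_nonneg (x₀ + s • w), mul_nonneg (sq_nonneg s) (sq_nonneg ‖w‖)]
  have hle : ∀ s : ℝ, ‖x₀ + s • w‖ ≤ 1 + s ^ 2 * ‖w‖ ^ 2 := fun s => by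
    have := hnorm s
    nlinarith [hge s]
  have hev : ∀ᶠ s in 𝓝[>] (0 : ℝ), ∀ i ∈ t,
      inner ℝ (a i) (x₀ + s • w) < ρ * ‖x₀ + s • w‖ := by
    rw [Finset.eventually_all]
    intro i hi
    by_cases hρ : inner ℝ (a i) x₀ = ρ
    · have hlim : Tendsto (fun s : ℝ => inner ℝ (a i) w + |ρ| * (s * ‖w‖ ^ 2)) (𝓝[>] 0)
          (𝓝 (inner ℝ (a i) w + |ρ| * (0 * ‖w‖ ^ 2))) :=
        tendsto_nhdsWithin_of_tendsto_nhds (Continuous.tendsto (by fun_prop) 0)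
      have hlt : inner ℝ (a i) w + |ρ| * (0 * ‖w‖ ^ 2) < 0 := by simpa using hneg i hi hρ
      filter_upwards [hlim.eventually_lt_const hlt, self_mem_nhdsWithin] with s hs hs0
      rw [inner_add_right, inner_smul_right, hρ]
      have h1 : ρ * (‖x₀ + s • w‖ - 1) ≥ -(|ρ| * (s ^ 2 * ‖w‖ ^ 2)) := by
        have h2 : |ρ * (‖x₀ + s • w‖ - 1)| ≤ |ρ| * (s ^ 2 * ‖w‖ ^ 2) := by
          rw [abs_mul, abs_of_nonneg (by linarith [hge s] : 0 ≤ ‖x₀ + s • w‖ - 1)]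
          exact mul_le_mul_of_nonneg_left (by linarith [hle s]) (abs_nonneg ρ)
        exact (abs_le.1 h2).1
      have h3 := mul_neg_of_pos_of_neg (show (0 : ℝ) < s from hs0) hs
      nlinarith
    · have hlim : Tendsto (fun s : ℝ => inner ℝ (a i) (x₀ + s • w) - ρ * ‖x₀ + s • w‖) (𝓝[>] 0)
          (𝓝 (inner ℝ (a i) (x₀ + (0 : ℝ) • w) - ρ * ‖x₀ + (0 : ℝ) • w‖)) :=
        tendsto_nhdsWithin_of_tendsto_nhds (Continuous.tendsto (by fun_prop) 0)
      have hlt : inner ℝ (a i) (x₀ + (0 : ℝ) • w) - ρ * ‖x₀ + (0 : ℝ) • w‖ < 0 := by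
        have := lt_of_le_of_ne (h.inner_le i hi) hρ
        simp only [zero_smul, add_zero, h.norm_eq]
        linarith
      filter_upwards [hlim.eventually_lt_const hlt] with s hs
      linarith
  obtain ⟨s, hs⟩ := hev.exists
  have hpos : 0 < ‖x₀ + s • w‖ := by linarith [hge s]
  obtain ⟨i, hi, hρ⟩ := h.exists_le (‖x₀ + s • w‖⁻¹ • (x₀ + s • w)) (by
    rw [norm_smul, norm_inv, norm_norm, inv_mul_cancel₀ hpos.ne'])
  rw [inner_smul_right, inv_mul_eq_div, le_div_iff₀ hpos] at hρ
  exact absurd (hs i hi) (not_lt.2 hρ)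

/-- Otherwise a hyperplane separates `ρ • x₀` from the active vectors, and the tangential part of
its normal is a forbidden descent direction. -/
theorem IsMinimaxDirection.smul_mem_convexHull [FiniteDimensional ℝ E] {a : ι → E} {t : Finset ι}
    {x₀ : E} {ρ : ℝ} (h : IsMinimaxDirection a t x₀ ρ) :
    ρ • x₀ ∈ convexHull ℝ (a '' {i | i ∈ t ∧ inner ℝ (a i) x₀ = ρ}) := by
  by_contra hmem
  have hfin : (a '' {i | i ∈ t ∧ inner ℝ (a i) x₀ = ρ}).Finite :=
    ((Finset.finite_toSet t).subset fun i hi => hi.1).image a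
  obtain ⟨f, u, hu, hf⟩ := geometric_hahn_banach_closed_point (convex_convexHull ℝ _)
    (hfin.isCompact_convexHull ℝ).isClosed hmem
  obtain ⟨v, rfl⟩ := (InnerProductSpace.toDual ℝ E).surjective f
  simp only [InnerProductSpace.toDual_apply_apply] at hu hf
  refine h.not_forall_inner_neg (w := v - inner ℝ x₀ v • x₀) ?_ fun i hi hiρ => ?_
  · rw [inner_sub_right, inner_smul_right, real_inner_self_eq_norm_sq, h.norm_eq]
    ring
  · have h1 := hu (a i) (subset_convexHull ℝ _ ⟨i, ⟨hi, hiρ⟩, rfl⟩)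
    rw [inner_smul_right, real_inner_comm] at hf
    rw [real_inner_comm] at h1
    rw [inner_sub_right, inner_smul_right, hiρ]
    linarith

/-- A minimax direction with small value forces one of the vectors to be close to the span of
fewer than `dim E` of the others. -/
theorem IsMinimaxDirection.exists_near_span [FiniteDimensional ℝ E] {a : ι → E}
    {t : Finset ι} {x₀ : E} {ρ : ℝ} (h : IsMinimaxDirection a t x₀ ρ) :
    ∃ i ∈ t, ∃ s ⊆ t, i ∉ s ∧ s.card < Module.finrank ℝ E ∧
      ∃ u ∈ Submodule.span ℝ (Set.range fun k : s => a k),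
        ‖a i - u‖ ≤ Module.finrank ℝ E * |ρ| := by
  classical
  obtain ⟨κ, _, z, w, hz, hind, hw, hw1, hsum⟩ :=
    eq_pos_convex_span_of_mem_convexHull h.smul_mem_convexHull
  choose f hf hfz using fun j => hz (Set.mem_range_self j)
  have hinj : Function.Injective f := fun j k hjk => hind.injective (by rw [← hfz, ← hfz, hjk])
  have hx₀ : x₀ ≠ 0 := norm_ne_zero_iff.1 (by rw [h.norm_eq]; exact one_ne_zero)
  -- The active vectors lie in the affine hyperplane `⟪·, x₀⟫ = ρ`, which saves one over the usual
  -- Carathéodory count.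
  have hcard : Fintype.card κ ≤ Module.finrank ℝ E := by
    have hle : vectorSpan ℝ (Set.range z) ≤ (ℝ ∙ x₀)ᗮ := by
      rw [vectorSpan_def, Submodule.span_le]
      rintro _ ⟨_, ⟨j, rfl⟩, _, ⟨k, rfl⟩, rfl⟩
      rw [SetLike.mem_coe, Submodule.mem_orthogonal_singleton_iff_inner_left]
      simp [← hfz, inner_sub_left, (hf j).2, (hf k).2]
    have h1 := hind.card_le_finrank_succ
    have h2 := Submodule.finrank_mono hle
    have h3 := Submodule.finrank_add_finrank_orthogonal (ℝ ∙ x₀)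
    rw [finrank_span_singleton hx₀] at h3
    omega
  have hne : Nonempty κ := by
    by_contra hne
    rw [not_nonempty_iff] at hne
    simp at hw1
  have hpos : (0 : ℝ) < Fintype.card κ := by exact_mod_cast Fintype.card_pos
  -- Dividing `∑ w k • z k = ρ • x₀` by a weight that is at least the average costs a factor of at
  -- most the dimension.
  obtain ⟨j, -, hj⟩ : ∃ j ∈ Finset.univ, (Fintype.card κ : ℝ)⁻¹ ≤ w j := by
    refine Finset.exists_le_of_sum_le Finset.univ_nonempty ?_
    rw [hw1, Finset.sum_const, Finset.card_univ, nsmul_eq_mul, mul_inv_cancel₀ hpos.ne']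
  refine ⟨f j, (hf j).1, (Finset.univ.erase j).image f, ?_, ?_, ?_,
    -∑ k ∈ Finset.univ.erase j, (w k / w j) • z k, ?_, ?_⟩
  · intro i hi
    obtain ⟨k, -, rfl⟩ := Finset.mem_image.1 hi
    exact (hf k).1
  · intro hmem
    obtain ⟨k, hk, hkj⟩ := Finset.mem_image.1 hmem
    exact Finset.ne_of_mem_erase hk (hinj hkj)
  · rw [Finset.card_image_of_injective _ hinj, Finset.card_erase_of_mem (Finset.mem_univ _),
      Finset.card_univ]
    have := Fintype.card_pos (α := κ)
    omega
  · refine Submodule.neg_mem _ (Submodule.sum_mem _ fun k hk => Submodule.smul_mem _ _ ?_)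
    exact Submodule.subset_span ⟨⟨f k, Finset.mem_image_of_mem f hk⟩, hfz k⟩
  · have hwj := hw j
    have hx : a (f j) - -∑ k ∈ Finset.univ.erase j, (w k / w j) • z k = (w j)⁻¹ • ρ • x₀ := by
      rw [← hsum, ← Finset.add_sum_erase _ _ (Finset.mem_univ j), smul_add, hfz, sub_neg_eq_add,
        inv_smul_smul₀ hwj.ne', Finset.smul_sum]
      simp only [smul_smul, div_eq_inv_mul]
    rw [hx, norm_smul, norm_smul, h.norm_eq, mul_one, Real.norm_eq_abs, Real.norm_eq_abs,
      abs_of_pos (inv_pos.2 hwj)]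
    refine mul_le_mul_of_nonneg_right ?_ (abs_nonneg ρ)
    refine (inv_le_of_inv_le₀ hpos hj).trans ?_
    exact_mod_cast hcard

end Geometry

/-! ### The condition number as a minimax value. -/

section ConditionNumber

variable {m : ℕ}

theorem rowVec_firstRows (a : ℕ → Metric.sphere (0 : EuclideanSpace ℝ (Fin m)) 1) (n : ℕ)
    (i : Fin n) : rowVec (firstRows a n) i = a i := rfl

theorem cos_maxMinAngle_eq {a : ℕ → Metric.sphere (0 : EuclideanSpace ℝ (Fin m)) 1} {n : ℕ}
    (hn : 0 < n) {x₀ : EuclideanSpace ℝ (Fin m)} {ρ : ℝ}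
    (h : IsMinimaxDirection (fun i => (a i : EuclideanSpace ℝ (Fin m))) (Finset.range n) x₀ ρ) :
    Real.cos (maxMinAngle (firstRows a n)) = ρ := by
  have : Nonempty (Fin n) := ⟨⟨0, hn⟩⟩
  have hx₀ : x₀ ≠ 0 := norm_ne_zero_iff.1 (by rw [h.norm_eq]; exact one_ne_zero)
  have ha : ∀ i, ‖(a i : EuclideanSpace ℝ (Fin m))‖ = 1 := fun i => by simp
  have hangle : ∀ (i : Fin n) {x : EuclideanSpace ℝ (Fin m)}, ‖x‖ = 1 →
      InnerProductGeometry.angle (rowVec (firstRows a n) i) x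
        = Real.arccos (inner ℝ (a i : EuclideanSpace ℝ (Fin m)) x) := fun i x hx => by
    rw [rowVec_firstRows, InnerProductGeometry.angle, ha, hx, mul_one, div_one]
  have hbdd : ∀ x, BddBelow (Set.range fun i : Fin n =>
      InnerProductGeometry.angle (rowVec (firstRows a n) i) x) := fun x =>
    ⟨0, by rintro _ ⟨i, rfl⟩; exact InnerProductGeometry.angle_nonneg _ _⟩
  have hle : ∀ x : {x : EuclideanSpace ℝ (Fin m) // x ≠ 0},
      minAngle (firstRows a n) x ≤ Real.arccos ρ := by
    rintro ⟨x, hx⟩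
    have hpos : 0 < ‖x‖⁻¹ := inv_pos.2 (norm_pos_iff.2 hx)
    have hnorm : ‖‖x‖⁻¹ • x‖ = 1 := by
      rw [norm_smul, norm_inv, norm_norm, inv_mul_cancel₀ (norm_ne_zero_iff.2 hx)]
    obtain ⟨i, hi, hρ⟩ := h.exists_le _ hnorm
    refine (ciInf_le (hbdd x) ⟨i, Finset.mem_range.1 hi⟩).trans ?_
    rw [← InnerProductGeometry.angle_smul_right_of_pos _ _ hpos, hangle _ hnorm]
    exact Real.arccos_le_arccos hρ
  have hmax : maxMinAngle (firstRows a n) = Real.arccos ρ := by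
    have : Nonempty {x : EuclideanSpace ℝ (Fin m) // x ≠ 0} := ⟨⟨x₀, hx₀⟩⟩
    refine le_antisymm (ciSup_le hle) ?_
    refine le_trans ?_ (le_ciSup (f := fun x : {x : EuclideanSpace ℝ (Fin m) // x ≠ 0} =>
      minAngle (firstRows a n) x) ⟨Real.arccos ρ, by rintro _ ⟨x, rfl⟩; exact hle x⟩ ⟨x₀, hx₀⟩)
    refine le_ciInf fun i => ?_
    rw [hangle i h.norm_eq]
    exact Real.arccos_le_arccos (h.inner_le i (Finset.mem_range.2 i.2))
  -- `ρ` is attained as an inner product of unit vectors, so it lies in `[-1, 1]`, where `cos`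
  -- inverts `arccos`.
  obtain ⟨i, hi, hρ⟩ := h.exists_le x₀ h.norm_eq
  have habs := abs_real_inner_le_norm (a i : EuclideanSpace ℝ (Fin m)) x₀
  rw [ha, h.norm_eq, mul_one, le_antisymm (h.inner_le i hi) hρ] at habs
  rw [hmax, Real.cos_arccos (abs_le.1 habs).1 (abs_le.1 habs).2]

theorem exists_near_span_of_firstRows (hm : 0 < m)
    (a : ℕ → Metric.sphere (0 : EuclideanSpace ℝ (Fin m)) 1) {n : ℕ} (hn : 0 < n) :
    ∃ i ∈ Finset.range n, ∃ s ⊆ Finset.range n, i ∉ s ∧ s.card < m ∧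
      ∃ u ∈ Submodule.span ℝ (Set.range fun k : s => (a k : EuclideanSpace ℝ (Fin m))),
        ‖(a i : EuclideanSpace ℝ (Fin m)) - u‖ ≤
          m * |Real.cos (maxMinAngle (firstRows a n))| := by
  have : NeZero m := ⟨hm.ne'⟩
  obtain ⟨x₀, ρ, h⟩ := exists_isMinimaxDirection
    (fun i => (a i : EuclideanSpace ℝ (Fin m))) (Finset.nonempty_range_iff.2 hn.ne')
  have := h.exists_near_span
  rw [finrank_euclideanSpace_fin] at this
  rwa [cos_maxMinAngle_eq hn h]

theorem le_cos_maxMinAngle (hm : 0 < m)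
    {a : ℕ → Metric.sphere (0 : EuclideanSpace ℝ (Fin m)) 1} {n : ℕ} (hn : 0 < n) {c : ℝ}
    (hc : ∀ x : EuclideanSpace ℝ (Fin m), ‖x‖ = 1 →
      ∃ i < n, c ≤ inner ℝ (a i : EuclideanSpace ℝ (Fin m)) x) :
    c ≤ Real.cos (maxMinAngle (firstRows a n)) := by
  have : NeZero m := ⟨hm.ne'⟩
  obtain ⟨x₀, ρ, h⟩ := exists_isMinimaxDirection
    (fun i => (a i : EuclideanSpace ℝ (Fin m))) (Finset.nonempty_range_iff.2 hn.ne')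
  rw [cos_maxMinAngle_eq hn h]
  obtain ⟨i, hi, hci⟩ := hc x₀ h.norm_eq
  exact hci.trans (h.inner_le i (Finset.mem_range.2 hi))

theorem one_le_condNumber {n : ℕ} (M : Matrix (Fin n) (Fin m) ℝ) : 1 ≤ condNumber M := by
  rw [condNumber, ENNReal.one_le_inv, ENNReal.ofReal_le_one]
  exact Real.abs_cos_le_one _

end ConditionNumber

/-! ### Uniform measure of slabs, and measurability of nearness to a span. -/

section Sphere

open scoped Pointwise

variable {m : ℕ}

theorem isProbabilityMeasure_uniformSphere (hm : 0 < m) :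
    IsProbabilityMeasure (uniformSphere m) := by
  have : NeZero m := ⟨hm.ne'⟩
  constructor
  rw [uniformSphere, Measure.smul_apply, smul_eq_mul]
  exact ENNReal.inv_mul_cancel (Measure.measure_univ_ne_zero.2 (Measure.toSphere_ne_zero _))
    (measure_ne_top _ _)

theorem uniformSphere_ball_pos {x : Metric.sphere (0 : EuclideanSpace ℝ (Fin m)) 1} {ε : ℝ}
    (hε : 0 < ε) : 0 < uniformSphere m (Metric.ball x ε) := by
  rw [uniformSphere, Measure.smul_apply, smul_eq_mul]
  exact ENNReal.mul_pos (ENNReal.inv_ne_zero.2 (measure_ne_top _ _))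
    (Metric.measure_ball_pos _ x hε).ne'

/-- In an orthonormal basis containing `v`, the cone over the slab fits in a box of half-width `t`
along `v` and `1` elsewhere; `toSphere` contributes the factor `m`. -/
theorem volume_toSphere_slab_le {v : EuclideanSpace ℝ (Fin m)} (hv : ‖v‖ = 1) (t : ℝ) :
    (volume : Measure (EuclideanSpace ℝ (Fin m))).toSphere {a | |inner ℝ v a| < t} ≤
      m * 2 ^ m * ENNReal.ofReal t := by
  obtain rfl | hm := m.eq_zero_or_pos
  · rw [Subsingleton.elim v 0] at hv
    simp at hv
  let j : Fin m := ⟨0, hm⟩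
  obtain ⟨b, hb⟩ := Orthonormal.exists_orthonormalBasis_extension_of_card_eq (𝕜 := ℝ)
    (E := EuclideanSpace ℝ (Fin m)) (ι := Fin m) (by simp) (v := fun _ => v) (s := {j})
    ⟨fun _ => hv, fun i k hik => absurd (Subsingleton.elim i k) hik⟩
  have hbj : b j = v := hb j rfl
  let c : Fin m → ℝ := Function.update (fun _ => 1) j t
  let box : Set (Fin m → ℝ) := Set.univ.pi fun i => Set.Ioo (-c i) (c i)
  have hbox : MeasurableSet box :=
    MeasurableSet.univ_pi fun i => measurableSet_Ioo
  have hsub : Set.Ioo (0 : ℝ) 1 • ((↑) '' {a : Metric.sphere (0 : EuclideanSpace ℝ (Fin m)) 1 |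
      |inner ℝ v (a : EuclideanSpace ℝ (Fin m))| < t}) ⊆ b.repr ⁻¹' (WithLp.ofLp ⁻¹' box) := by
    rintro _ ⟨r, hr, _, ⟨a, ha, rfl⟩, rfl⟩
    have hr0 := hr.1
    have hr1 := hr.2
    simp only [Set.mem_ofPred_eq] at ha
    simp only [Set.mem_preimage, box, Set.mem_univ_pi]
    intro i
    rw [Set.mem_Ioo, ← abs_lt, b.repr_apply_apply, inner_smul_right, abs_mul, abs_of_pos hr0]
    by_cases hij : i = j
    · subst hij
      rw [hbj]
      simp only [c, Function.update_self]
      nlinarith [abs_nonneg (inner ℝ v (a : EuclideanSpace ℝ (Fin m)))]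
    · simp only [c, Function.update_of_ne hij]
      have h1 := abs_real_inner_le_norm (b i) (a : EuclideanSpace ℝ (Fin m))
      rw [b.norm_eq_one, norm_eq_of_mem_sphere, mul_one] at h1
      nlinarith
  rw [Measure.toSphere_apply' _ (by measurability), finrank_euclideanSpace_fin, mul_assoc]
  gcongr
  refine (measure_mono hsub).trans ?_
  rw [b.measurePreserving_repr.measure_preimage
      ((WithLp.measurable_ofLp 2 _ hbox).nullMeasurableSet),
    (PiLp.volume_preserving_ofLp (Fin m)).measure_preimage hbox.nullMeasurableSet,
    Real.volume_pi_Ioo]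
  have hfac : ∀ i, ENNReal.ofReal (c i - -c i) =
      2 * Function.update (fun _ => (1 : ENNReal)) j (ENNReal.ofReal t) i := fun i => by
    rw [sub_neg_eq_add, ← two_mul, ENNReal.ofReal_mul zero_le_two, ENNReal.ofReal_ofNat]
    by_cases hij : i = j
    · subst hij
      simp [c]
    · simp [c, Function.update_of_ne hij]
  simp only [hfac, Finset.prod_mul_distrib, Finset.prod_const, Finset.card_univ, Fintype.card_fin,
    Finset.prod_update_of_mem (Finset.mem_univ j), one_pow, mul_one, le_refl]

theorem exists_uniformSphere_slab_le (hm : 0 < m) : ∃ C : ENNReal, C ≠ ⊤ ∧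
    ∀ v : EuclideanSpace ℝ (Fin m), ‖v‖ = 1 → ∀ t : ℝ,
      uniformSphere m {a | |inner ℝ v a| < t} ≤ C * ENNReal.ofReal t := by
  have : NeZero m := ⟨hm.ne'⟩
  refine ⟨((volume : Measure (EuclideanSpace ℝ (Fin m))).toSphere Set.univ)⁻¹ * (m * 2 ^ m),
    ENNReal.mul_ne_top (ENNReal.inv_ne_top.2
      (Measure.measure_univ_ne_zero.2 (Measure.toSphere_ne_zero _))) ?_, fun v hv t => ?_⟩
  · exact ENNReal.mul_ne_top (ENNReal.natCast_ne_top m) (ENNReal.pow_ne_top ENNReal.ofNat_ne_top)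
  · rw [uniformSphere, Measure.smul_apply, smul_eq_mul, mul_assoc]
    gcongr
    exact volume_toSphere_slab_le hv t

/-- Supplies the measurability that Fubini needs in `measure_near_span_le`. -/
theorem isOpen_setOf_near_span {E κ : Type*} [NormedAddCommGroup E] [NormedSpace ℝ E] [Fintype κ]
    (t : ℝ) : IsOpen {p : Metric.sphere (0 : E) 1 × (κ → Metric.sphere (0 : E) 1) |
      ∃ u ∈ Submodule.span ℝ (Set.range fun k => (p.2 k : E)), ‖(p.1 : E) - u‖ < t} := by
  have : {p : Metric.sphere (0 : E) 1 × (κ → Metric.sphere (0 : E) 1) |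
      ∃ u ∈ Submodule.span ℝ (Set.range fun k => (p.2 k : E)), ‖(p.1 : E) - u‖ < t} =
      ⋃ c : κ → ℝ, {p | ‖(p.1 : E) - ∑ k, c k • (p.2 k : E)‖ < t} := by
    ext p
    simp [Submodule.mem_span_range_iff_exists_fun]
  rw [this]
  exact isOpen_iUnion fun c => isOpen_lt (by fun_prop) continuous_const

theorem exists_unit_orthogonal_span {E κ : Type*} [NormedAddCommGroup E] [InnerProductSpace ℝ E]
    [FiniteDimensional ℝ E] [Fintype κ] (b : κ → E)
    (hκ : Fintype.card κ < Module.finrank ℝ E) :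
    ∃ v : E, ‖v‖ = 1 ∧ ∀ u ∈ Submodule.span ℝ (Set.range b), inner ℝ v u = 0 := by
  have hne : (Submodule.span ℝ (Set.range b))ᗮ ≠ ⊥ := by
    rw [Ne, Submodule.orthogonal_eq_bot_iff]
    intro htop
    have := finrank_range_le_card (R := ℝ) b
    rw [Set.finrank, htop, finrank_top] at this
    omega
  obtain ⟨v, hv, hv0⟩ := Submodule.exists_mem_ne_zero_of_ne_bot hne
  refine ⟨‖v‖⁻¹ • v, ?_, fun u hu => ?_⟩
  · rw [norm_smul, norm_inv, norm_norm, inv_mul_cancel₀ (norm_ne_zero_iff.2 hv0)]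
  · rw [inner_smul_left, Submodule.inner_left_of_mem_orthogonal hu hv, mul_zero]

end Sphere

/-! ### Tail and covering estimates for independent rows. -/

section Random

variable {Ω : Type*} [MeasurableSpace Ω] {P : Measure Ω} {m : ℕ}
  {A : ℕ → Ω → Metric.sphere (0 : EuclideanSpace ℝ (Fin m)) 1}

/-- With the rows in `s` frozen, a unit normal `v` to their span satisfies `|⟪v, a⟫| ≤ ‖a - u‖`, so
the event lies in a slab. -/
theorem measure_near_span_le [IsProbabilityMeasure P]
    (hlaw : ∀ i, HasLaw (A i) (uniformSphere m) P)
    (hindep : iIndepFun A P) {C : ENNReal}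
    (hC : ∀ v : EuclideanSpace ℝ (Fin m), ‖v‖ = 1 → ∀ t : ℝ,
      uniformSphere m {a | |inner ℝ v a| < t} ≤ C * ENNReal.ofReal t)
    {i : ℕ} {s : Finset ℕ} (hi : i ∉ s) (hs : s.card < m) (t : ℝ) :
    P {ω | ∃ u ∈ Submodule.span ℝ (Set.range fun k : s => (A k ω : EuclideanSpace ℝ (Fin m))),
      ‖(A i ω : EuclideanSpace ℝ (Fin m)) - u‖ < t} ≤ C * ENNReal.ofReal t := by
  let F : Ω → s → Metric.sphere (0 : EuclideanSpace ℝ (Fin m)) 1 := fun ω k => A k ω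
  have hF : AEMeasurable F P := aemeasurable_pi_lambda _ fun k => (hlaw k).aemeasurable
  have hAF : IndepFun (A i) F P :=
    (hindep.indepFun_finset₀ {i} s (Finset.disjoint_singleton_left.2 hi)
      fun k => (hlaw k).aemeasurable).comp
      (measurable_pi_apply (⟨i, Finset.mem_singleton_self i⟩ : ({i} : Finset ℕ))) measurable_id
  have hU := (isOpen_setOf_near_span (E := EuclideanSpace ℝ (Fin m)) (κ := s) t).measurableSet
  have hprob : IsProbabilityMeasure (P.map F) := Measure.isProbabilityMeasure_map hF
  have hprob' := isProbabilityMeasure_uniformSphere (m := m) (by omega)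
  have hmap := hAF.map_prod_eq_prod_map_map (hlaw i).aemeasurable hF
  rw [(hlaw i).map_eq] at hmap
  have hP := Measure.map_apply_of_aemeasurable ((hlaw i).aemeasurable.prodMk hF) hU
  rw [hmap, Measure.prod_apply_symm hU] at hP
  refine hP.symm.le.trans ?_
  calc _ ≤ ∫⁻ _, C * ENNReal.ofReal t ∂(P.map F) := by
        refine lintegral_mono fun b => ?_
        obtain ⟨v, hv, hvu⟩ := exists_unit_orthogonal_span
          (fun k => (b k : EuclideanSpace ℝ (Fin m))) (by simpa using hs)
        refine (measure_mono ?_).trans (hC v hv t)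
        rintro a ⟨u, hu, hau⟩
        refine lt_of_le_of_lt ?_ hau
        have h1 := abs_real_inner_le_norm v ((a : EuclideanSpace ℝ (Fin m)) - u)
        rwa [hv, one_mul, inner_sub_right, hvu u hu, sub_zero] at h1
    _ = C * ENNReal.ofReal t := by rw [lintegral_const, measure_univ, mul_one]

theorem measure_abs_cos_maxMinAngle_le [IsProbabilityMeasure P] (hm : 0 < m)
    (hlaw : ∀ i, HasLaw (A i) (uniformSphere m) P)
    (hindep : iIndepFun A P) {C : ENNReal}
    (hC : ∀ v : EuclideanSpace ℝ (Fin m), ‖v‖ = 1 → ∀ t : ℝ,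
      uniformSphere m {a | |inner ℝ v a| < t} ≤ C * ENNReal.ofReal t)
    {n : ℕ} (hn : 0 < n) {ε : ℝ} (hε : 0 < ε) :
    P {ω | |Real.cos (maxMinAngle (firstRows (fun i => A i ω) n))| ≤ ε} ≤
      m * n ^ (m + 1) * (C * ENNReal.ofReal ((m + 1) * ε)) := by
  -- Union bound: `n` choices of row, `m` possible cardinalities, at most `n ^ m` subsets of each.
  -- The factor `m + 1` in place of `m` makes the distance inequality strict.
  let T : Finset (ℕ × Finset ℕ) :=
    (Finset.range n ×ˢ (Finset.range m).biUnion fun j => (Finset.range n).powersetCard j).filter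
      fun p => p.1 ∉ p.2 ∧ p.2.card < m
  have hT : T.card ≤ m * n ^ (m + 1) := by
    have h1 : ((Finset.range m).biUnion fun j => (Finset.range n).powersetCard j).card ≤
        (Finset.range m).card * n ^ m := by
      refine Finset.card_biUnion_le_card_mul _ _ _ fun j hj => ?_
      rw [Finset.card_powersetCard, Finset.card_range]
      exact (Nat.choose_le_pow n j).trans
        (Nat.pow_le_pow_right hn (Finset.mem_range.1 hj).le)
    rw [Finset.card_range] at h1
    refine (Finset.card_filter_le _ _).trans ?_
    rw [Finset.card_product, Finset.card_range]
    exact (Nat.mul_le_mul_left n h1).trans_eq (by ring)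
  have hsub : {ω | |Real.cos (maxMinAngle (firstRows (fun i => A i ω) n))| ≤ ε} ⊆
      ⋃ p ∈ T, {ω | ∃ u ∈ Submodule.span ℝ
        (Set.range fun k : p.2 => (A k ω : EuclideanSpace ℝ (Fin m))),
          ‖(A p.1 ω : EuclideanSpace ℝ (Fin m)) - u‖ < (m + 1) * ε} := by
    intro ω hω
    obtain ⟨i, hi, s, hs, his, hcard, u, hu, hdist⟩ :=
      exists_near_span_of_firstRows hm (fun i => A i ω) hn
    refine Set.mem_biUnion (x := (i, s)) ?_ ⟨u, hu, hdist.trans_lt ?_⟩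
    · rw [Finset.mem_coe, Finset.mem_filter, Finset.mem_product]
      refine ⟨⟨hi, Finset.mem_biUnion.2 ⟨s.card, Finset.mem_range.2 hcard, ?_⟩⟩, his, hcard⟩
      exact Finset.mem_powersetCard.2 ⟨hs, rfl⟩
    · have : (m : ℝ) * |Real.cos (maxMinAngle (firstRows (fun i => A i ω) n))| ≤ m * ε :=
        mul_le_mul_of_nonneg_left hω (Nat.cast_nonneg m)
      linarith
  refine ((measure_mono hsub).trans (measure_biUnion_finset_le T _)).trans ?_
  refine (Finset.sum_le_card_nsmul T _ (C * ENNReal.ofReal ((m + 1) * ε)) fun p hp => ?_).trans ?_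
  · have hp' := (Finset.mem_filter.1 hp).2
    exact measure_near_span_le hlaw hindep hC hp'.1 hp'.2 _
  · rw [nsmul_eq_mul]
    gcongr
    exact_mod_cast hT

/-- The condition number has a tail of order `1 / t`, with a constant polynomial in `n`. -/
theorem exists_measure_two_pow_le_condNumber_le [IsProbabilityMeasure P] (hm : 0 < m)
    (hlaw : ∀ i, HasLaw (A i) (uniformSphere m) P) (hindep : iIndepFun A P) :
    ∃ D : ENNReal, D ≠ ⊤ ∧ ∀ n : ℕ, 0 < n → ∀ k : ℕ,
      P {ω | 2 ^ k ≤ condNumber (firstRows (fun i => A i ω) n)} ≤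
        D * n ^ (m + 1) * 2⁻¹ ^ k := by
  obtain ⟨C, hCtop, hC⟩ := exists_uniformSphere_slab_le hm
  refine ⟨m * (C * ENNReal.ofReal (m + 1)), ENNReal.mul_ne_top (ENNReal.natCast_ne_top m)
    (ENNReal.mul_ne_top hCtop ENNReal.ofReal_ne_top), fun n hn k => ?_⟩
  have hε : (0 : ℝ) < 2⁻¹ ^ k := by positivity
  have hofReal : ENNReal.ofReal (2⁻¹ ^ k) = 2⁻¹ ^ k := by
    rw [ENNReal.ofReal_pow (by norm_num), ENNReal.ofReal_inv_of_pos two_pos, ENNReal.ofReal_ofNat]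
  refine (measure_mono fun ω hω => ?_).trans
    ((measure_abs_cos_maxMinAngle_le hm hlaw hindep hC hn hε).trans_eq ?_)
  · rw [Set.mem_ofPred_eq, condNumber, ENNReal.le_inv_iff_le_inv, ENNReal.inv_pow, ← hofReal,
      ENNReal.ofReal_le_ofReal_iff hε.le] at hω
    exact hω
  · rw [ENNReal.ofReal_mul (by positivity), hofReal]
    ring

/-- The probability that the first `n` vectors fail to be `arccos c`-dense in the sphere decays
exponentially. -/
theorem exists_measure_not_covering_le (hm : 0 < m)
    (hlaw : ∀ i, HasLaw (A i) (uniformSphere m) P) (hindep : iIndepFun A P) {c : ℝ} (hc : c < 1) :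
    ∃ N : ℕ, ∃ q : ENNReal, q < 1 ∧ ∀ n : ℕ,
      P {ω | ¬ ∀ x : EuclideanSpace ℝ (Fin m), ‖x‖ = 1 →
        ∃ i < n, c ≤ inner ℝ (A i ω : EuclideanSpace ℝ (Fin m)) x} ≤ N * q ^ n := by
  have hprob := isProbabilityMeasure_uniformSphere hm
  -- Unit vectors at distance below `2 * ε` have inner product above `1 - 2 * ε ^ 2 = c`.
  let ε : ℝ := √((1 - c) / 2)
  have hε : 0 < ε := Real.sqrt_pos.2 (by linarith)
  have hε2 : ε ^ 2 = (1 - c) / 2 := Real.sq_sqrt (by linarith)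
  obtain ⟨t, -, htfin, hcover⟩ := (isCompact_univ
    (X := Metric.sphere (0 : EuclideanSpace ℝ (Fin m)) 1)).finite_cover_balls hε
  lift t to Finset (Metric.sphere (0 : EuclideanSpace ℝ (Fin m)) 1) using htfin
  refine ⟨t.card, t.sup fun y => uniformSphere m (Metric.ball y ε)ᶜ, ?_, fun n => ?_⟩
  · rw [Finset.sup_lt_iff (by simp)]
    intro y _
    rw [prob_compl_eq_one_sub Metric.isOpen_ball.measurableSet]
    exact ENNReal.sub_lt_self ENNReal.one_ne_top one_ne_zero (uniformSphere_ball_pos hε).ne'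
  have hsub : {ω | ¬ ∀ x : EuclideanSpace ℝ (Fin m), ‖x‖ = 1 →
        ∃ i < n, c ≤ inner ℝ (A i ω : EuclideanSpace ℝ (Fin m)) x} ⊆
      ⋃ y ∈ t, ⋂ i ∈ Finset.range n, A i ⁻¹' (Metric.ball y ε)ᶜ := by
    intro ω hω
    by_contra hnot
    refine hω fun x hx => ?_
    obtain ⟨y, hy, hxy⟩ := Set.mem_iUnion₂.1
      (hcover (Set.mem_univ (⟨x, by simpa using hx⟩ :
        Metric.sphere (0 : EuclideanSpace ℝ (Fin m)) 1)))
    have hex : ∃ i < n, A i ω ∈ Metric.ball y ε := by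
      by_contra hno
      refine hnot (Set.mem_biUnion hy (Set.mem_iInter₂.2 fun i hi hmem => hno ?_))
      exact ⟨i, Finset.mem_range.1 hi, hmem⟩
    obtain ⟨i, hi, hiy⟩ := hex
    refine ⟨i, hi, ?_⟩
    have hdist : ‖(A i ω : EuclideanSpace ℝ (Fin m)) - x‖ < ε + ε := by
      rw [← dist_eq_norm]
      exact (dist_triangle_right (A i ω : EuclideanSpace ℝ (Fin m)) x y).trans_lt
        (add_lt_add hiy hxy)
    have hsq := norm_sub_sq_real (A i ω : EuclideanSpace ℝ (Fin m)) x
    rw [hx, norm_eq_of_mem_sphere] at hsq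
    nlinarith [norm_nonneg ((A i ω : EuclideanSpace ℝ (Fin m)) - x)]
  refine ((measure_mono hsub).trans (measure_biUnion_finset_le t _)).trans ?_
  rw [← nsmul_eq_mul]
  refine Finset.sum_le_card_nsmul t _ _ fun y hy => ?_
  have hmeas : MeasurableSet (Metric.ball y ε)ᶜ := Metric.isOpen_ball.measurableSet.compl
  rw [hindep.measure_inter_preimage_eq_mul (Finset.range n) fun _ _ => hmeas]
  refine (Finset.prod_le_pow_card _ _ _ fun i _ => ?_).trans_eq (by rw [Finset.card_range])
  rw [← Measure.map_apply_of_aemeasurable (hlaw i).aemeasurable hmeas, (hlaw i).map_eq]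
  exact Finset.le_sup (f := fun y => uniformSphere m (Metric.ball y ε)ᶜ) hy

end Random

/-! ### Dyadic moment bounds and interpolation. -/

section Moments

/-- Measurable hulls of the `S k` have the same measure, so neither `f` nor the `S k` need be
measurable. -/
theorem lintegral_le_add_tsum_mul_measure {Ω : Type*} [MeasurableSpace Ω] {P : Measure Ω}
    [IsProbabilityMeasure P] {f : Ω → ENNReal} {c₀ : ENNReal} {c : ℕ → ENNReal} {S : ℕ → Set Ω}
    (hf : ∀ ω, f ω ≤ c₀ + ∑' k, (S k).indicator (fun _ => c k) ω) :
    ∫⁻ ω, f ω ∂P ≤ c₀ + ∑' k, c k * P (S k) := by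
  calc ∫⁻ ω, f ω ∂P
      ≤ ∫⁻ ω, c₀ + ∑' k, (toMeasurable P (S k)).indicator (fun _ => c k) ω ∂P := by
        refine lintegral_mono fun ω => (hf ω).trans ?_
        gcongr with k
        exact subset_toMeasurable P (S k)
    _ = c₀ + ∑' k, c k * P (S k) := by
        rw [lintegral_add_left measurable_const, lintegral_const, measure_univ, mul_one,
          lintegral_tsum fun k =>
            (measurable_const.indicator (measurableSet_toMeasurable P (S k))).aemeasurable]
        simp only [lintegral_indicator_const (measurableSet_toMeasurable P _), measure_toMeasurable]

theorem ENNReal.one_le_rpow_of_nonneg {x : ENNReal} (hx : 1 ≤ x) {γ : ℝ} (hγ : 0 ≤ γ) :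
    1 ≤ x ^ γ := by
  simpa using ENNReal.rpow_le_rpow hx hγ

theorem ENNReal.rpow_le_tsum_dyadic {x : ENNReal} (hx : 1 ≤ x) {γ : ℝ} (hγ : 0 ≤ γ) :
    x ^ γ ≤ ∑' k : ℕ, {k : ℕ | 2 ^ k ≤ x}.indicator (fun k => ((2 : ENNReal) ^ (k + 1)) ^ γ) k := by
  by_cases htop : x = ⊤
  · subst htop
    have : ∑' _ : ℕ, (1 : ENNReal) ≤ ∑' k : ℕ,
        {k : ℕ | 2 ^ k ≤ (⊤ : ENNReal)}.indicator (fun k => ((2 : ENNReal) ^ (k + 1)) ^ γ) k := by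
      refine ENNReal.tsum_le_tsum fun k => ?_
      rw [Set.indicator_of_mem (by simp)]
      exact ENNReal.one_le_rpow_of_nonneg (one_le_pow₀ one_le_two) hγ
    rw [ENNReal.tsum_const_eq_top_of_ne_zero one_ne_zero] at this
    exact le_top.trans this
  · lift x to NNReal using htop
    obtain ⟨k, hk, hk'⟩ := exists_nat_pow_near (show (1 : NNReal) ≤ x by exact_mod_cast hx)
      _root_.one_lt_two
    refine le_trans ?_ (ENNReal.le_tsum k)
    rw [Set.indicator_of_mem (by rw [Set.mem_ofPred_eq]; exact_mod_cast hk)]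
    exact ENNReal.rpow_le_rpow (by exact_mod_cast hk'.le) hγ

/-- Used with `x` the probability of an intersection, to share the exponential bound and the tail
bound. -/
theorem ENNReal.le_rpow_mul_rpow_of_le {x a b : ENNReal} (ha : x ≤ a) (hb : x ≤ b) {β : ℝ}
    (hβ₀ : 0 ≤ β) (hβ₁ : β ≤ 1) : x ≤ a ^ (1 - β) * b ^ β := by
  calc x = x ^ (1 - β) * x ^ β := by
        rw [← ENNReal.rpow_add_of_nonneg _ _ (sub_nonneg.2 hβ₁) hβ₀, sub_add_cancel,
          ENNReal.rpow_one]
    _ ≤ a ^ (1 - β) * b ^ β :=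
        mul_le_mul' (ENNReal.rpow_le_rpow ha (sub_nonneg.2 hβ₁)) (ENNReal.rpow_le_rpow hb hβ₀)

theorem ENNReal.tendsto_natCast_pow_mul_pow {q : ENNReal} (hq : q < 1) (k : ℕ) :
    Tendsto (fun n : ℕ => (n : ENNReal) ^ k * q ^ n) atTop (𝓝 0) := by
  lift q to NNReal using hq.ne_top
  have hq' : |(q : ℝ)| < 1 := by
    rw [NNReal.abs_eq]
    exact_mod_cast hq
  have h := tendsto_pow_const_mul_const_pow_of_abs_lt_one k hq'
  have h' : Tendsto (fun n : ℕ => (n : NNReal) ^ k * q ^ n) atTop (𝓝 0) := by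
    rw [← NNReal.tendsto_coe]
    simpa using h
  simpa using ENNReal.tendsto_coe.2 h'

theorem tendsto_rpow_mul_rpow_zero {N D q : ENNReal} (hN : N ≠ ⊤) (hD : D ≠ ⊤) (hq : q < 1)
    (k : ℕ) {β : ℝ} (hβ₀ : 0 ≤ β) (hβ₁ : β < 1) :
    Tendsto (fun n : ℕ => (N * q ^ n) ^ (1 - β) * (D * (n : ENNReal) ^ k) ^ β) atTop (𝓝 0) := by
  have hβ : 0 < 1 - β := sub_pos.2 hβ₁
  have hq' : q ^ (1 - β) < 1 := ENNReal.rpow_lt_one hq hβ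
  have hlim := ENNReal.Tendsto.const_mul (a := N ^ (1 - β) * D ^ β)
    (ENNReal.tendsto_natCast_pow_mul_pow hq' k) (Or.inr (ENNReal.mul_ne_top
      (ENNReal.rpow_ne_top_of_nonneg hβ.le hN) (ENNReal.rpow_ne_top_of_nonneg hβ₀ hD)))
  rw [mul_zero] at hlim
  refine tendsto_of_tendsto_of_tendsto_of_le_of_le' tendsto_const_nhds hlim
    (Eventually.of_forall fun _ => zero_le) ?_
  filter_upwards [eventually_ge_atTop 1] with n hn
  have hn' : (1 : ENNReal) ≤ (n : ENNReal) ^ k := one_le_pow₀ (by exact_mod_cast hn)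
  have hpow : ((n : ENNReal) ^ k) ^ β ≤ (n : ENNReal) ^ k := by
    simpa using ENNReal.rpow_le_rpow_of_exponent_le hn' hβ₁.le
  rw [ENNReal.mul_rpow_of_nonneg _ _ hβ.le, ENNReal.mul_rpow_of_nonneg _ _ hβ₀,
    ← ENNReal.rpow_natCast_mul, mul_comm (n : ℝ), ENNReal.rpow_mul_natCast]
  calc _ ≤ N ^ (1 - β) * (q ^ (1 - β)) ^ n * (D ^ β * (n : ENNReal) ^ k) := by gcongr
    _ = _ := by ring

/-- A geometric series of ratio `2 ^ (γ - β) < 1`. -/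
theorem tsum_dyadic_ne_top {γ β : ℝ} (h : γ < β) :
    ∑' k : ℕ, ((2 : ENNReal) ^ (k + 1)) ^ γ * ((2⁻¹ : ENNReal) ^ k) ^ β ≠ ⊤ := by
  have hterm : ∀ k : ℕ, ((2 : ENNReal) ^ (k + 1)) ^ γ * ((2⁻¹ : ENNReal) ^ k) ^ β =
      2 ^ γ * ((2 : ENNReal) ^ (γ - β)) ^ k := fun k => by
    rw [← ENNReal.inv_pow, ENNReal.inv_rpow, ← ENNReal.rpow_neg]
    simp only [← ENNReal.rpow_natCast, ← ENNReal.rpow_mul]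
    rw [← ENNReal.rpow_add _ _ two_ne_zero ENNReal.ofNat_ne_top,
      ← ENNReal.rpow_add _ _ two_ne_zero ENNReal.ofNat_ne_top]
    congr 1
    push_cast
    ring
  simp only [hterm]
  rw [ENNReal.tsum_mul_left, ENNReal.tsum_geometric]
  refine ENNReal.mul_ne_top (ENNReal.rpow_ne_top_of_ne_zero two_ne_zero ENNReal.ofNat_ne_top) ?_
  rw [ENNReal.inv_ne_top]
  exact (tsub_pos_of_lt (ENNReal.rpow_lt_one_of_one_lt_of_neg ENNReal.one_lt_two (by linarith))).ne'

end Moments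

/-! ### Convergence of the moments. -/

theorem mainTheorem10 {Ω : Type*} [MeasurableSpace Ω] (P : Measure Ω) [IsProbabilityMeasure P]
    (m : ℕ) (hm : 3 ≤ m)
    (A : ℕ → Ω → Metric.sphere (0 : EuclideanSpace ℝ (Fin m)) 1)
    (hlaw : ∀ i, HasLaw (A i) (uniformSphere m) P)
    (hindep : iIndepFun A P)
    (γ : ℝ) (hγ₀ : 0 ≤ γ) (hγ₁ : γ < 1) :
    Tendsto (fun n : ℕ => ∫⁻ ω, condNumber (firstRows (fun i => A i ω) n) ^ γ ∂P)
      atTop (𝓝 1) := by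
  have hm₀ : 0 < m := by omega
  -- `γ < β` makes the dyadic series converge; `β < 1` keeps a positive power of `q ^ n`.
  obtain ⟨β, hγβ, hβ₁⟩ := exists_between hγ₁
  have hβ₀ : 0 ≤ β := hγ₀.trans hγβ.le
  obtain ⟨D, hD, htail⟩ := exists_measure_two_pow_le_condNumber_le hm₀ hlaw hindep
  refine tendsto_order.2 ⟨fun b hb => Eventually.of_forall fun n => hb.trans_le ?_, fun b hb => ?_⟩
  · calc (1 : ENNReal) = ∫⁻ _, 1 ∂P := by simp
      _ ≤ _ := lintegral_mono fun ω =>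
        ENNReal.one_le_rpow_of_nonneg (one_le_condNumber _) hγ₀
  obtain ⟨c, ⟨hc₀, hc₁⟩, hcb⟩ : ∃ c : ℝ, (0 < c ∧ c < 1) ∧ (ENNReal.ofReal c)⁻¹ < b := by
    have hlim : Tendsto (fun c : ℝ => (ENNReal.ofReal c)⁻¹) (𝓝[<] 1) (𝓝 1) := by
      have : Continuous fun c : ℝ => (ENNReal.ofReal c)⁻¹ :=
        ENNReal.continuous_ofReal.inv
      simpa using tendsto_nhdsWithin_of_tendsto_nhds (s := Set.Iio 1) (this.tendsto 1)
    have hpos : ∀ᶠ c : ℝ in 𝓝[<] 1, 0 < c :=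
      eventually_nhdsWithin_of_eventually_nhds (lt_mem_nhds one_pos)
    obtain ⟨c, hc⟩ := (hpos.and (eventually_mem_nhdsWithin.and (hlim.eventually_lt_const hb))).exists
    exact ⟨c, ⟨hc.1, hc.2.1⟩, hc.2.2⟩
  obtain ⟨N, q, hq, hbad⟩ := exists_measure_not_covering_le hm₀ hlaw hindep hc₁
  let K : ENNReal := ∑' k : ℕ, ((2 : ENNReal) ^ (k + 1)) ^ γ * ((2⁻¹ : ENNReal) ^ k) ^ β
  have hbound : ∀ n : ℕ, 0 < n →
      ∫⁻ ω, condNumber (firstRows (fun i => A i ω) n) ^ γ ∂P ≤ (ENNReal.ofReal c)⁻¹ +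
        K * ((N * q ^ n) ^ (1 - β) * (D * (n : ENNReal) ^ (m + 1)) ^ β) := by
    intro n hn
    let B : Set Ω := {ω | ¬ ∀ x : EuclideanSpace ℝ (Fin m), ‖x‖ = 1 →
        ∃ i < n, c ≤ inner ℝ (A i ω : EuclideanSpace ℝ (Fin m)) x}
    let S : ℕ → Set Ω := fun k => B ∩ {ω | 2 ^ k ≤ condNumber (firstRows (fun i => A i ω) n)}
    refine (lintegral_le_add_tsum_mul_measure (c₀ := (ENNReal.ofReal c)⁻¹)
      (c := fun k => ((2 : ENNReal) ^ (k + 1)) ^ γ) (S := S) fun ω => ?_).trans ?_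
    · have hone := one_le_condNumber (firstRows (fun i => A i ω) n)
      by_cases hω : ω ∈ B
      · refine (ENNReal.rpow_le_tsum_dyadic hone hγ₀).trans (le_add_left (le_of_eq ?_))
        refine tsum_congr fun k => ?_
        by_cases hk : 2 ^ k ≤ condNumber (firstRows (fun i => A i ω) n)
        · rw [Set.indicator_of_mem (by exact hk),
            Set.indicator_of_mem (show ω ∈ S k from ⟨hω, hk⟩)]
        · rw [Set.indicator_of_notMem (by exact hk),
            Set.indicator_of_notMem (show ω ∉ S k from fun h => hk h.2)]
      -- Off `B`, `cos θ ≥ c`; since `𝒞 ≥ 1` and `γ < 1`, `𝒞 ^ γ ≤ 𝒞 ≤ 1 / c`.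
      · refine le_add_right ?_
        have hcos := le_cos_maxMinAngle hm₀ (a := fun i => A i ω) hn (not_not.1 hω)
        calc condNumber (firstRows (fun i => A i ω) n) ^ γ
            ≤ condNumber (firstRows (fun i => A i ω) n) := by
              simpa using ENNReal.rpow_le_rpow_of_exponent_le hone hγ₁.le
          _ ≤ (ENNReal.ofReal c)⁻¹ :=
              ENNReal.inv_le_inv.2 (ENNReal.ofReal_le_ofReal (hcos.trans (le_abs_self _)))
    · rw [← ENNReal.tsum_mul_right]
      gcongr (ENNReal.ofReal c)⁻¹ + ?_
      refine ENNReal.tsum_le_tsum fun k => ?_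
      have hS := ENNReal.le_rpow_mul_rpow_of_le
        ((measure_mono Set.inter_subset_left).trans (hbad n))
        ((measure_mono Set.inter_subset_right).trans (htail n hn k)) hβ₀ hβ₁.le
      rw [ENNReal.mul_rpow_of_nonneg _ (2⁻¹ ^ k) hβ₀] at hS
      refine (mul_le_mul_right hS _).trans_eq ?_
      ring
  have hlim := ENNReal.Tendsto.const_mul (a := K) (tendsto_rpow_mul_rpow_zero
    (ENNReal.natCast_ne_top N) hD hq (m + 1) hβ₀ hβ₁) (Or.inr (tsum_dyadic_ne_top hγβ))
  have hlim' := hlim.const_add (ENNReal.ofReal c)⁻¹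
  rw [mul_zero, add_zero] at hlim'
  filter_upwards [hlim'.eventually_lt_const hcb, eventually_gt_atTop 0] with n hlt hn
  exact (hbound n hn).trans_lt hlt
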